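/- Let $d\ge 0$ be an integer, let $\mathbb{K}$ be $\mathbb{R}$ or $\mathbb{C}$, and let $\|\cdot\|$ be any norm on the space $\mathbb{K}^{d\times d}$ of $d\times d$ matrices. For a finite set $\mathcal{A}\subset\mathbb{K}^{d\times d}$ and $n\ge 0$ let $$m_n(\mathcal{A}):=\max\{\|A_1A_2\cdots A_n\| : A_1,\dots,A_n\in\mathcal{A}\}$$ (with the maximum of the empty set read as $0$), and call $\mathcal{A}$ non-degenerate if $m_n(\mathcal{A})\not\to 0$ as $n\to\infty$. Let $\mathcal{A}$ be a finite non-degenerate set of $d\times d$ matrices with integer entries. Then the limits $$\rho(\mathcal{A}):=\lim_{n\to\infty} m_n(\mathcal{A})^{1/n}\in\mathbb{R},\qquad \mathrm{GrDeg}(\mathcal{A}):=\lim_{n\to\infty}\frac{\log m_n(\mathcal{A})}{\log n}\in[-\infty,\infty]$$ (the joint spectral radius and the growth degree of $\mathcal{A}$) exist, and $\mathrm{GrDeg}(\mathcal{A})\in\mathbb{Z}_{\ge 0}\cup\{\infty\}$. Moreover, $\mathrm{GrDeg}(\mathcal{A})\in\mathbb{Z}_{\ge 0}$ if and only if $\rho(\mathcal{A})=1$,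 and in this case, with $k:=\mathrm{GrDeg}(\mathcal{A})$, there are positive constants $C_1$ and $C_2$ such that $$C_1n^k\le m_n(\mathcal{A})\le C_2n^k\qquad\text{for all } n\ge 1.$$ -/

import Mathlib

open Filter Topology

namespace MatrixGrowth

variable {𝕜 : Type*} [RCLike 𝕜] {d : ℕ}

/-- The maximum of the norm `N` over all products `A₁ ⋯ Aₙ` of `n` (not necessarily distinct)
elements of the finite set `𝒜`.  The index type `Fin n → 𝒜` is finite, so the supremum is a
maximum as soon as `𝒜` is nonempty. -/
noncomputable def maxNorm (N : Seminorm 𝕜 (Matrix (Fin d) (Fin d) 𝕜))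
    (𝒜 : Finset (Matrix (Fin d) (Fin d) 𝕜)) (n : ℕ) : ℝ :=
  ⨆ w : Fin n → 𝒜, N (List.ofFn fun i => (w i : Matrix (Fin d) (Fin d) 𝕜)).prod

/-- `𝒜` is non-degenerate if `maxNorm N 𝒜 n` does not tend to `0`. -/
def NonDegenerate (N : Seminorm 𝕜 (Matrix (Fin d) (Fin d) 𝕜))
    (𝒜 : Finset (Matrix (Fin d) (Fin d) 𝕜)) : Prop :=
  ¬ Tendsto (maxNorm N 𝒜) atTop (𝓝 0)

/-- The sequence `m_n(𝒜)^(1/n)`. -/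
noncomputable def rootSeq (N : Seminorm 𝕜 (Matrix (Fin d) (Fin d) 𝕜))
    (𝒜 : Finset (Matrix (Fin d) (Fin d) 𝕜)) (n : ℕ) : ℝ :=
  maxNorm N 𝒜 n ^ (1 / (n : ℝ))

/-- The joint spectral radius, `lim m_n(𝒜)^(1/n)`. -/
noncomputable def jointSpectralRadius (N : Seminorm 𝕜 (Matrix (Fin d) (Fin d) 𝕜))
    (𝒜 : Finset (Matrix (Fin d) (Fin d) 𝕜)) : ℝ :=
  limUnder atTop (rootSeq N 𝒜)

/-- The sequence `log m_n(𝒜) / log n`, regarded in the extended reals so that it may have the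
limit `∞`. -/
noncomputable def logRatio (N : Seminorm 𝕜 (Matrix (Fin d) (Fin d) 𝕜))
    (𝒜 : Finset (Matrix (Fin d) (Fin d) 𝕜)) (n : ℕ) : EReal :=
  ((Real.log (maxNorm N 𝒜 n) / Real.log n : ℝ) : EReal)

/-- The growth degree, `lim log m_n(𝒜) / log n`, for a non-degenerate set `𝒜`. -/
noncomputable def grDeg (N : Seminorm 𝕜 (Matrix (Fin d) (Fin d) 𝕜))
    (𝒜 : Finset (Matrix (Fin d) (Fin d) 𝕜)) : EReal :=
  limUnder atTop (logRatio N 𝒜)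

end MatrixGrowth

/-! Submultiplicativity gives m_n^(1/n) → e^L, and L ≥ 0 because a nonzero integer matrix has an
entry of modulus at least 1, which keeps m_n away from 0. If L > 0, growth is exponential. If L = 0,
the eigenvalues of all products lie in the closed unit disc, and Kronecker's theorem makes the
nonzero ones roots of unity of a common order B; hence every product M satisfies M^d (M^B - 1)^d =
0.

Let R be the complex algebra generated by the matrices, so that words span it. In an R-module the
vectors with finite orbit under the words form a submodule; iterating in the quotients gives
`filtration`, F_0 = 0 ⊆ F_1 ⊆ ⋯. It exhausts the module because words act on a simple module through
finitely many maps (Burnside's trace argument, `finiteAction_of_isSimpleModule`). The growth degree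
is the k with 1 ∈ F_{k+1} \ F_k, taken in R itself.

Upper bound: each further layer costs one factor n (`exists_norm_smul_le_of_mem_filtration`). Lower
bound: an infinite orbit in a quotient forces a word w such that the powers of w^B do not become
constant there (`finiteAction_of_torsion`), so they depend on the exponent through a nonconstant
polynomial. Concatenating such powers layer by layer gives words of length linear in t with product
polynomial in t, of degree at least k (`exists_pumping`). Submultiplicativity then fills the gaps
between these lengths (`exists_pow_bounds`). -/

open Filter Topology

namespace MatrixGrowth

/-! ### Products along words -/

section WordProducts

variable {R ι : Type*} [Ring R] (A : ι → R)

/-- The product of the elements `A i` along the word `w`. -/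
def wordProd (w : List ι) : R := (w.map A).prod

@[simp] theorem wordProd_nil : wordProd A [] = 1 := by simp [wordProd]

@[simp] theorem wordProd_cons (i : ι) (w : List ι) :
    wordProd A (i :: w) = A i * wordProd A w := by simp [wordProd]

@[simp] theorem wordProd_append (u w : List ι) :
    wordProd A (u ++ w) = wordProd A u * wordProd A w := by simp [wordProd]

theorem wordProd_flatten_replicate (n : ℕ) (w : List ι) :
    wordProd A (List.replicate n w).flatten = wordProd A w ^ n := by
  induction n with
  | zero => simp
  | succ n ih => simp [List.replicate_succ, ih, pow_succ']

/-- The words act on the module `V` through finitely many maps. -/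
def FiniteAction (V : Type*) [AddCommGroup V] [Module R V] : Prop :=
  (Set.range fun (w : List ι) (v : V) => wordProd A w • v).Finite

end WordProducts

/-! ### Burnside's theorem on simple modules -/

section FiniteAction

open Polynomial

/-- The trace is a sum of dim V eigenvalues, each of them a root of P. -/
theorem finite_trace_of_aeval_eq_zero {K V : Type*} [Field K] [IsAlgClosed K] [AddCommGroup V]
    [Module K V] [FiniteDimensional K V] {P : K[X]} (hP : P ≠ 0) :
    {t | ∃ f : Module.End K V, aeval f P = 0 ∧ LinearMap.trace K V f = t}.Finite := by
  classical
  refine (Set.finite_range fun g : Fin (Module.finrank K V) → P.roots.toFinset =>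
    ∑ i, (g i : K)).subset ?_
  rintro t ⟨f, hf, rfl⟩
  have hs := IsAlgClosed.splits f.charpoly
  have hmem : ∀ μ ∈ f.charpoly.roots, μ ∈ P.roots.toFinset := by
    intro μ hμ
    have h1 : f.HasEigenvalue μ :=
      (Module.End.hasEigenvalue_iff_isRoot_charpoly f μ).2 (isRoot_of_mem_roots hμ)
    obtain ⟨v, hv⟩ := h1.exists_hasEigenvector
    have h2 := Module.End.aeval_apply_of_hasEigenvector (p := P) hv
    rw [hf] at h2
    have h3 : P.eval μ = 0 := by
      have := h2.symm
      simpa [hv.2] using this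
    simp [hP, h3]
  have hlen : f.charpoly.roots.toList.length = Module.finrank K V := by
    rw [Multiset.length_toList, ← hs.natDegree_eq_card_roots, LinearMap.charpoly_natDegree]
  refine ⟨fun i => ⟨f.charpoly.roots.toList.get (i.cast hlen.symm), hmem _ ?_⟩, ?_⟩
  · rw [← Multiset.mem_toList]; exact List.get_mem _ _
  · rw [Module.End.trace_eq_sum_roots_charpoly_of_splits hs]
    rw [← Multiset.sum_toList (s := f.charpoly.roots), ← Fin.sum_univ_getElem]
    exact Fintype.sum_equiv (finCongr hlen.symm) _ _ (fun i => rfl)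

variable {K R ι : Type*} [Field K] [IsAlgClosed K] [Ring R] [Algebra K R] {A : ι → R}

/-- By Schur and Jacobson density R maps onto End V, so finitely many words e span End V. The trace
form is nondegenerate, so a word w is determined by the traces of the products we. These are again
words, killed by P, so their traces take finitely many values. -/
theorem finiteAction_of_isSimpleModule
    (hA : Submodule.span K (Set.range (wordProd A)) = ⊤)
    (V : Type*) [AddCommGroup V] [Module K V] [Module R V] [IsScalarTower K R V]
    [FiniteDimensional K V] [IsSimpleModule R V] {P : K[X]} (hP : P ≠ 0)
    (h : ∀ w (v : V), aeval (wordProd A w) P • v = 0) : FiniteAction A V := by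
  classical
  let ρ : R →ₐ[K] Module.End K V := Algebra.lsmul K K V
  have hsurj : Function.Surjective ρ := by
    intro f
    let g : Module.End (Module.End R V) V :=
      { toFun := f
        map_add' := f.map_add
        map_smul' := fun e v => by
          obtain ⟨c, rfl⟩ :=
            (IsSimpleModule.algebraMap_end_bijective_of_isAlgClosed (A := R) (V := V) K).2 e
          simp }
    obtain ⟨s, hs⟩ := (Module.Finite.fg_top : (⊤ : Submodule K V).FG)
    obtain ⟨r, hr⟩ := jacobson_density (R := R) g s
    refine ⟨r, LinearMap.ext_on (s := (s : Set V)) hs fun v hv => ?_⟩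
    exact (hr v hv).symm
  have hspan : Submodule.span K (Set.range fun w => ρ (wordProd A w)) = ⊤ := by
    have : (Set.range fun w => ρ (wordProd A w)) = ρ.toLinearMap '' Set.range (wordProd A) := by
      rw [← Set.range_comp]; rfl
    rw [this, Submodule.span_image, hA, Submodule.map_top, LinearMap.range_eq_top]
    exact hsurj
  have hfg : (Submodule.span K (Set.range fun w => ρ (wordProd A w))).FG := by
    rw [hspan]; exact Module.Finite.fg_top
  obtain ⟨s, hs, hse⟩ := Submodule.fg_span_iff_fg_span_finset_subset _ |>.1 hfg
  rw [hspan] at hse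
  let Φ : Module.End K V → s → K := fun f e => LinearMap.trace K V (f * e)
  have hΦ : Function.Injective Φ := by
    intro f g hfg
    have h1 : ∀ x : Module.End K V, LinearMap.trace K V (f * x) = LinearMap.trace K V (g * x) := by
      intro x
      have hx : x ∈ Submodule.span K (s : Set (Module.End K V)) := hse ▸ Submodule.mem_top
      induction hx using Submodule.span_induction with
      | mem x hx => exact congrFun hfg ⟨x, hx⟩
      | zero => simp
      | add x y _ _ hx hy => simp [mul_add, hx, hy]
      | smul c x _ hx => simp [hx]
    let b := Module.Free.chooseBasis K V
    apply (LinearMap.toMatrixAlgEquiv b).injective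
    rw [Matrix.ext_iff_trace_mul_right]
    intro x
    obtain ⟨x, rfl⟩ := (LinearMap.toMatrixAlgEquiv b).surjective x
    rw [← map_mul, ← map_mul]
    have h2 := h1 x
    rwa [LinearMap.trace_eq_matrix_trace K b, LinearMap.trace_eq_matrix_trace K b] at h2
  have hfin : (Set.range fun w => ρ (wordProd A w)).Finite := by
    refine Set.Finite.of_finite_image (f := Φ) ?_ hΦ.injOn
    refine (Set.Finite.pi' fun _ : s =>
      finite_trace_of_aeval_eq_zero (K := K) (V := V) hP).subset ?_
    rintro _ ⟨_, ⟨w, rfl⟩, rfl⟩ e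
    obtain ⟨u, hu⟩ := hs e.2
    refine ⟨_, ?_, rfl⟩
    have : ρ (wordProd A w) * (e : Module.End K V) = ρ (wordProd A (w ++ u)) := by
      rw [← hu]; simp
    rw [this, aeval_algHom_apply]
    ext v
    exact h _ v
  refine (hfin.image fun f : Module.End K V => (f : V → V)).subset ?_
  rintro _ ⟨w, rfl⟩
  exact ⟨_, ⟨w, rfl⟩, rfl⟩

end FiniteAction


/-! ### Finiteness from uniformly bounded periods -/

section Torsion

open Polynomial

universe u

variable {K R ι : Type*} [Field K] [Ring R] [Algebra K R] {A : ι → R}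

/-- The error e = yzv - zv lies in U, where xy acts as x, so x y^i e = xe for all i. Summing over i
= a, …, a+b-1 telescopes to x y^(a+b) zv - x y^a zv = 0. Thus b • xe = 0, and torsion-freeness gives
xe = 0. -/
theorem smul_delete_of_torsion {V : Type*} [AddCommGroup V] [Module R V]
    [IsAddTorsionFree V] (U : Submodule R V) {a b : ℕ} (hb : b ≠ 0) {x y z : R}
    (hy : ∀ v : V, y ^ (a + b) • v = y ^ a • v)
    (hU : ∀ u ∈ U, (x * y) • u = x • u) (hQ : ∀ v : V, (y * z) • v - z • v ∈ U) (v : V) :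
    (x * y * z) • v = (x * z) • v := by
  set e := (y * z) • v - z • v with he
  have hpow : ∀ i, (x * y ^ i) • e = x • e := by
    intro i
    induction i with
    | zero => simp
    | succ i ih =>
      have hmem : y ^ i • e ∈ U := U.smul_mem _ (hQ v)
      rw [pow_succ', ← mul_assoc, mul_smul, hU _ hmem, ← mul_smul, ih]
  have hsum : ∀ m, m • (x • e) = (x * y ^ (a + m) * z) • v - (x * y ^ a * z) • v := by
    intro m
    induction m with
    | zero => simp
    | succ m ih =>
      rw [succ_nsmul, ih, ← hpow (a + m), he, smul_sub, ← mul_smul, ← mul_smul]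
      simp only [mul_assoc, ← add_assoc, pow_succ]
      abel
  have h0 : b • (x • e) = 0 := by
    rw [hsum b, sub_eq_zero]
    have := congrArg (x • ·) (hy (z • v))
    simpa [mul_smul] using this
  have h1 : x • e = 0 := by
    have := (nsmul_right_injective hb (M := V)) (a₁ := x • e) (a₂ := 0) (by simpa using h0)
    exact this
  rw [he, smul_sub, sub_eq_zero] at h1
  simpa [mul_smul] using h1

/-- Pigeonhole: in a long word two cut positions have prefixes acting equally on U and suffixes
acting equally on V/U. The segment between them can be deleted by `smul_delete_of_torsion`, so words
of bounded length already give every action. -/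
theorem FiniteAction.of_submodule [Finite ι] {V : Type*} [AddCommGroup V] [Module R V]
    [IsAddTorsionFree V] (U : Submodule R V) (hU : FiniteAction A U)
    (hQ : FiniteAction A (V ⧸ U)) {a b : ℕ} (hb : b ≠ 0)
    (h : ∀ w (v : V), wordProd A w ^ (a + b) • v = wordProd A w ^ a • v) :
    FiniteAction A V := by
  classical
  have := hU.to_subtype
  have := hQ.to_subtype
  let F := (Set.range fun (w : List ι) (u : U) => wordProd A w • u) ×
    (Set.range fun (w : List ι) (u : V ⧸ U) => wordProd A w • u)
  let k := Nat.card F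
  have hshort : ∀ n, ∀ w : List ι, w.length ≤ n →
      ∃ w' : List ι, w'.length ≤ k ∧ ∀ v : V, wordProd A w • v = wordProd A w' • v := by
    intro n
    induction n with
    | zero => exact fun w hw => ⟨w, by omega, fun _ => rfl⟩
    | succ n ih =>
      intro w hw
      by_cases hk : w.length ≤ k
      · exact ⟨w, hk, fun _ => rfl⟩
      let c : Fin (k + 1) → F := fun i =>
        (⟨_, w.take i, rfl⟩, ⟨_, w.drop i, rfl⟩)
      have hc : ¬ Function.Injective c := by
        intro hc
        have := Nat.card_le_card_of_injective c hc
        simp [k] at this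
      obtain ⟨i, j, hij, hlt⟩ : ∃ i j, c i = c j ∧ i < j := by
        simp only [Function.Injective, not_forall] at hc
        obtain ⟨i, j, hij, hne⟩ := hc
        rcases lt_or_gt_of_ne hne with hlt | hlt
        · exact ⟨i, j, hij, hlt⟩
        · exact ⟨j, i, hij.symm, hlt⟩
      have hlt' : (i : ℕ) < j := hlt
      have hj : (j : ℕ) ≤ k := by omega
      set x := w.take i
      set y := (w.drop i).take (j - i)
      set z := w.drop j
      have hxy : x ++ y = w.take j := by
        have := List.take_add (l := w) (i := i) (j := j - i)
        rw [show (i : ℕ) + (j - i) = j by omega] at this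
        exact this.symm
      have hyz : y ++ z = w.drop i := by
        have := List.take_append_drop (j - i) (w.drop i)
        rwa [List.drop_drop, show (i : ℕ) + (j - i) = j by omega] at this
      have hw' : w = x ++ y ++ z := by rw [hxy]; simp [z]
      have h1 := congrArg (fun p : F => (p.1 : U → U)) hij
      have h2 := congrArg (fun p : F => (p.2 : V ⧸ U → V ⧸ U)) hij
      simp only [c] at h1 h2
      have key : ∀ v : V, wordProd A w • v = wordProd A (x ++ z) • v := by
        intro v
        rw [hw', wordProd_append, wordProd_append, wordProd_append]
        refine smul_delete_of_torsion U hb (h y) ?_ ?_ v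
        · intro u hu
          have := congrArg Subtype.val (congrFun h1 ⟨u, hu⟩)
          rw [← wordProd_append, hxy]
          exact this.symm
        · intro v
          have := congrFun h2 (Submodule.Quotient.mk v)
          rw [← wordProd_append, hyz, ← Submodule.Quotient.eq]
          exact this
      obtain ⟨w', hw1, hw2⟩ := ih (x ++ z) (by simp [x, z]; omega)
      exact ⟨w', hw1, fun v => (key v).trans (hw2 v)⟩
  refine ((List.finite_length_le ι k).image fun w (v : V) => wordProd A w • v).subset ?_
  rintro _ ⟨w, rfl⟩
  obtain ⟨w', h1, h2⟩ := hshort _ w le_rfl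
  exact ⟨w', h1, funext fun v => (h2 v).symm⟩

/-- A finitely generated semigroup of matrices with uniformly bounded periods is finite. -/
theorem finiteAction_of_torsion [Finite ι] [IsAlgClosed K] [CharZero K]
    (hA : Submodule.span K (Set.range (wordProd A)) = ⊤) {a b : ℕ} (hb : b ≠ 0) :
    ∀ (n : ℕ) (V : Type u) [AddCommGroup V] [Module K V] [Module R V] [IsScalarTower K R V]
      [FiniteDimensional K V], Module.finrank K V ≤ n →
      (∀ w (v : V), wordProd A w ^ (a + b) • v = wordProd A w ^ a • v) → FiniteAction A V := by
  intro n
  induction n with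
  | zero =>
    intro V _ _ _ _ _ hn _
    have : Subsingleton V := Module.finrank_zero_iff.1 (Nat.le_zero.1 hn)
    exact Set.toFinite _
  | succ n ih =>
    intro V _ _ _ _ _ hn h
    rcases subsingleton_or_nontrivial V with hV | hV
    · exact Set.toFinite _
    by_cases hs : IsSimpleModule R V
    · refine finiteAction_of_isSimpleModule (K := K) hA V (P := X ^ (a + b) - X ^ a) ?_ ?_
      · intro h0
        have := congrArg (fun p : K[X] => p.coeff (a + b)) h0
        simp [coeff_X_pow, hb] at this
      · intro w v
        simp [sub_smul, h w v]
    · obtain ⟨U, hU0, hU1⟩ : ∃ U : Submodule R V, U ≠ ⊥ ∧ U ≠ ⊤ := by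
        by_contra! hcon
        refine hs (isSimpleModule_iff _ _ |>.2 ⟨fun U => ?_⟩)
        by_cases hU : U = ⊥
        · exact Or.inl hU
        · exact Or.inr (hcon U hU)
      have hfin : FiniteDimensional K U :=
        inferInstanceAs (FiniteDimensional K (U.restrictScalars K))
      have hlt1 : Module.finrank K U < Module.finrank K V := by
        refine Submodule.finrank_lt (s := U.restrictScalars K) ?_
        simpa using hU1
      have hlt2 : Module.finrank K (V ⧸ U) < Module.finrank K V := by
        have h1 := Submodule.finrank_quotient_add_finrank (U.restrictScalars K)
        have h2 : 0 < Module.finrank K (U.restrictScalars K) := by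
          rw [Module.finrank_pos_iff, Submodule.nontrivial_iff_ne_bot]
          simpa using hU0
        have h3 : Module.finrank K (V ⧸ U) = Module.finrank K (V ⧸ U.restrictScalars K) := rfl
        omega
      let _ : Module ℚ V := Module.compHom V (algebraMap ℚ K)
      have : IsAddTorsionFree V := IsAddTorsionFree.of_module_rat V
      refine FiniteAction.of_submodule U (ih U (by omega) ?_) (ih (V ⧸ U) (by omega) ?_) hb h
      · intro w u
        exact Subtype.ext (h w u)
      · intro w q
        obtain ⟨v, rfl⟩ := Submodule.Quotient.mk_surjective U q
        exact congrArg Submodule.Quotient.mk (h w v)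

end Torsion


/-! ### The finite-orbit filtration and the upper bound -/

section Filtration

open Polynomial

variable {K R ι : Type*} [Field K] [Ring R] [Algebra K R] {A : ι → R}
  (hA : Submodule.span K (Set.range (wordProd A)) = ⊤)

/-- The submodule of vectors with a finite orbit under the words. -/
def finiteOrbits (V : Type*) [AddCommGroup V] [Module K V] [Module R V] [IsScalarTower K R V] :
    Submodule R V where
  carrier := {v | (Set.range fun w : List ι => wordProd A w • v).Finite}
  zero_mem' := (Set.finite_singleton (0 : V)).subset (by rintro _ ⟨w, rfl⟩; simp)
  add_mem' := by
    intro v v' hv hv'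
    refine (Set.Finite.add hv hv').subset ?_
    rintro _ ⟨w, rfl⟩
    exact ⟨_, ⟨w, rfl⟩, _, ⟨w, rfl⟩, (smul_add _ _ _).symm⟩
  smul_mem' := by
    intro r v hv
    -- Here the spanning hypothesis is essential: r is a combination of words, and the orbit of a
    -- word applied to v lies inside the orbit of v.
    have hr : r ∈ Submodule.span K (Set.range (wordProd A)) := hA ▸ Submodule.mem_top
    simp only [Set.mem_ofPred_eq] at hv ⊢
    induction hr using Submodule.span_induction with
    | mem x hx =>
      obtain ⟨u, rfl⟩ := hx
      refine hv.subset ?_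
      rintro _ ⟨w, rfl⟩
      exact ⟨w ++ u, by simp [mul_smul]⟩
    | zero =>
      refine (Set.finite_singleton (0 : V)).subset ?_
      rintro _ ⟨w, rfl⟩
      simp
    | add x y _ _ hx hy =>
      refine (Set.Finite.add hx hy).subset ?_
      rintro _ ⟨w, rfl⟩
      exact ⟨_, ⟨w, rfl⟩, _, ⟨w, rfl⟩, by simp [add_smul]⟩
    | smul c x _ hx =>
      refine (hx.image (c • ·)).subset ?_
      rintro _ ⟨w, rfl⟩
      exact ⟨_, ⟨w, rfl⟩, by simp only [smul_assoc]; rw [smul_comm]⟩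

theorem mem_finiteOrbits {V : Type*} [AddCommGroup V] [Module K V] [Module R V]
    [IsScalarTower K R V] {v : V} :
    v ∈ finiteOrbits hA V ↔ (Set.range fun w : List ι => wordProd A w • v).Finite := Iff.rfl

theorem FiniteAction.mem_finiteOrbits {V : Type*} [AddCommGroup V] [Module K V] [Module R V]
    [IsScalarTower K R V] {U : Submodule R V} (hU : FiniteAction A U) {v : V} (hv : v ∈ U) :
    v ∈ finiteOrbits hA V := by
  refine (hU.image fun f => (f ⟨v, hv⟩ : V)).subset ?_
  rintro _ ⟨w, rfl⟩
  exact ⟨_, ⟨w, rfl⟩, rfl⟩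

/-- A minimal submodule is simple, hence has finite action. -/
theorem finiteOrbits_ne_bot [IsAlgClosed K] (V : Type*) [AddCommGroup V] [Module K V]
    [Module R V] [IsScalarTower K R V] [FiniteDimensional K V] [Nontrivial V] {P : K[X]}
    (hP : P ≠ 0) (h : ∀ w, aeval (wordProd A w) P = 0) : finiteOrbits hA V ≠ ⊥ := by
  have : IsArtinian R V := isArtinian_of_tower K inferInstance
  obtain ⟨U, hU, -⟩ := (eq_bot_or_exists_atom_le (⊤ : Submodule R V)).resolve_left top_ne_bot
  have : IsSimpleModule R U := isSimpleModule_iff_isAtom.2 hU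
  have hfin : FiniteDimensional K U :=
    inferInstanceAs (FiniteDimensional K (U.restrictScalars K))
  have hact : FiniteAction A U :=
    finiteAction_of_isSimpleModule (K := K) hA U hP fun w v => by simp [h w]
  intro hbot
  refine hU.1 (eq_bot_iff.2 fun v hv => ?_)
  rw [← hbot]
  exact hact.mem_finiteOrbits hA hv

/-- Otherwise the periodicity, known on all translates of v by words, extends linearly to the cyclic
module Rv, and `finiteAction_of_torsion` makes the orbit of v finite. -/
theorem exists_pow_smul_ne_of_notMem_finiteOrbits [Finite ι] [IsAlgClosed K] [CharZero K]
    {V : Type*} [AddCommGroup V] [Module K V] [Module R V] [IsScalarTower K R V]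
    [FiniteDimensional K V] {v : V} (hv : v ∉ finiteOrbits hA V) (a : ℕ) {b : ℕ} (hb : b ≠ 0) :
    ∃ w x, wordProd A w ^ (a + b) • wordProd A x • v ≠ wordProd A w ^ a • wordProd A x • v := by
  by_contra! hcon
  let U : Submodule R V := Submodule.span R {v}
  have hfin : FiniteDimensional K U :=
    inferInstanceAs (FiniteDimensional K (U.restrictScalars K))
  refine hv (FiniteAction.mem_finiteOrbits hA (U := U) ?_ (Submodule.mem_span_singleton_self v))
  refine finiteAction_of_torsion (K := K) hA (a := a) hb _ U le_rfl fun w u => Subtype.ext ?_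
  obtain ⟨r, hr⟩ := Submodule.mem_span_singleton.1 u.2
  simp only [Submodule.coe_smul, ← hr]
  have hrm : r ∈ Submodule.span K (Set.range (wordProd A)) := hA ▸ Submodule.mem_top
  clear hr
  induction hrm using Submodule.span_induction with
  | mem x hx =>
    obtain ⟨x, rfl⟩ := hx
    exact hcon w x
  | zero => simp
  | add x y _ _ hx hy => rw [add_smul, smul_add, smul_add, hx, hy]
  | smul c x _ hx => rw [smul_assoc, smul_comm, hx, smul_comm]

/-- The ascending filtration whose successive quotients consist of the vectors with finite
orbits. -/
def filtration (V : Type*) [AddCommGroup V] [Module K V] [Module R V] [IsScalarTower K R V] :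
    ℕ → Submodule R V
  | 0 => ⊥
  | q + 1 => (finiteOrbits hA (V ⧸ filtration V q)).comap (filtration V q).mkQ

section

variable (V : Type*) [AddCommGroup V] [Module K V] [Module R V] [IsScalarTower K R V]

theorem filtration_zero : filtration hA V 0 = ⊥ := rfl

theorem mem_filtration_succ {q : ℕ} {v : V} : v ∈ filtration hA V (q + 1) ↔
    (Submodule.Quotient.mk v : V ⧸ filtration hA V q) ∈ finiteOrbits hA _ := Iff.rfl

theorem filtration_mono : Monotone (filtration hA V) := by
  refine monotone_nat_of_le_succ fun q v hv => ?_
  rw [mem_filtration_succ, (Submodule.Quotient.mk_eq_zero _).2 hv]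
  exact zero_mem _

theorem exists_filtration_eq_top [IsAlgClosed K] [FiniteDimensional K V] {P : K[X]}
    (hP : P ≠ 0) (h : ∀ w, aeval (wordProd A w) P = 0) : ∃ q, filtration hA V q = ⊤ := by
  have : IsNoetherian R V := isNoetherian_of_tower K inferInstance
  obtain ⟨q, hq⟩ := monotone_stabilizes_iff_noetherian.2 this
    ⟨filtration hA V, filtration_mono hA V⟩
  refine ⟨q, ?_⟩
  by_contra hne
  have : Nontrivial (V ⧸ filtration hA V q) := Submodule.Quotient.nontrivial_iff.2 hne
  refine finiteOrbits_ne_bot hA (V ⧸ filtration hA V q) hP h (eq_bot_iff.2 fun x hx => ?_)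
  obtain ⟨v, rfl⟩ := Submodule.Quotient.mk_surjective _ x
  have h1 : v ∈ filtration hA V (q + 1) := hx
  have h2 : filtration hA V q = filtration hA V (q + 1) := hq (q + 1) q.le_succ
  rw [← h2] at h1
  exact (Submodule.Quotient.mk_eq_zero _).2 h1

end

/-- Choose representatives of V/U in V. The orbit of v in V/U is finite, so the errors made when a
letter is moved past a representative form a finite subset of U. Up to a bounded representative, wv
is a sum of |w| + 1 translated errors, each of one degree less by induction. -/
theorem exists_norm_smul_le_of_mem_filtration [Finite ι] (V : Type*) [NormedAddCommGroup V]
    [Module K V] [Module R V] [IsScalarTower K R V] (q : ℕ) :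
    ∀ v ∈ filtration hA V (q + 1), ∃ C : ℝ, ∀ w : List ι,
      ‖wordProd A w • v‖ ≤ C * ((w.length : ℝ) + 1) ^ q := by
  induction q with
  | zero =>
    intro v hv
    rw [mem_filtration_succ, mem_finiteOrbits] at hv
    have hfin : (Set.range fun w : List ι => wordProd A w • v).Finite := by
      refine Set.Finite.of_finite_image (f := (filtration hA V 0).mkQ) (hv.subset ?_) ?_
      · rintro _ ⟨_, ⟨w, rfl⟩, rfl⟩
        exact ⟨w, rfl⟩
      · refine (LinearMap.ker_eq_bot.1 ?_).injOn
        rw [Submodule.ker_mkQ, filtration_zero]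
    obtain ⟨C, hC⟩ := (hfin.image norm).bddAbove
    exact ⟨C, fun w => by simpa using hC ⟨_, ⟨w, rfl⟩, rfl⟩⟩
  | succ q ih =>
    intro v hv
    rw [mem_filtration_succ, mem_finiteOrbits] at hv
    set U := filtration hA V (q + 1)
    let rep : V ⧸ U → V := Quotient.out
    have hrep : ∀ x, (Submodule.Quotient.mk (rep x) : V ⧸ U) = x := fun x => Quotient.out_eq x
    let O := Set.range fun w : List ι => wordProd A w • (Submodule.Quotient.mk v : V ⧸ U)
    have hO : O.Finite := hv
    let G : Set V := {v - rep (Submodule.Quotient.mk v)} ∪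
      Set.image2 (fun i o => A i • rep o - rep (A i • o)) Set.univ O
    have hG : G.Finite := (Set.finite_singleton _).union (Set.Finite.image2 _ Set.finite_univ hO)
    have hGU : ∀ g ∈ G, g ∈ U := by
      rintro g (rfl | ⟨i, -, o, -, rfl⟩)
      · rw [← Submodule.Quotient.mk_eq_zero, Submodule.Quotient.mk_sub, hrep, sub_self]
      · rw [← Submodule.Quotient.mk_eq_zero, Submodule.Quotient.mk_sub,
          Submodule.Quotient.mk_smul, hrep, hrep, sub_self]
    obtain ⟨C, hC0, hC⟩ : ∃ C : ℝ, 0 ≤ C ∧ ∀ g ∈ G, ∀ y : List ι,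
        ‖wordProd A y • g‖ ≤ C * ((y.length : ℝ) + 1) ^ q := by
      choose! c hc using ih
      obtain ⟨C, hC⟩ := (hG.image c).bddAbove
      refine ⟨max C 0, le_max_right _ _, fun g hg y => (hc g (hGU g hg) y).trans ?_⟩
      gcongr
      exact (hC ⟨g, hg, rfl⟩).trans (le_max_left _ _)
    -- The outer word y is carried along because the induction on w moves the first letter of i :: w
    -- to the end of y.
    have claim : ∀ w y : List ι, ‖wordProd A y • (wordProd A w • v -
        rep (wordProd A w • (Submodule.Quotient.mk v : V ⧸ U)))‖ ≤
        C * ((w.length : ℝ) + 1) * ((y.length : ℝ) + w.length + 1) ^ q := by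
      intro w
      induction w with
      | nil =>
        intro y
        simpa using hC _ (Or.inl rfl) y
      | cons i w ihw =>
        intro y
        have h1 := ihw (y ++ [i])
        have h2 := hC _ (Or.inr ⟨i, Set.mem_univ i, _, ⟨w, rfl⟩, rfl⟩) y
        have h3 : C * ((y.length : ℝ) + 1) ^ q ≤
            C * ((y.length : ℝ) + (w.length + 1) + 1) ^ q := by
          gcongr
          linarith [(Nat.cast_nonneg w.length : (0 : ℝ) ≤ _)]
        have h4 := norm_add_le_of_le h1 (h2.trans h3)
        refine (le_of_eq ?_).trans (h4.trans (le_of_eq ?_))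
        · congr 1
          simp only [wordProd_append, wordProd_cons, wordProd_nil, mul_one, mul_smul, smul_sub]
          abel
        · simp only [List.length_append, List.length_cons, List.length_nil]
          push_cast
          ring
    obtain ⟨C', hC'⟩ := (hO.image fun o => ‖rep o‖).bddAbove
    refine ⟨max C' 0 + C, fun w => ?_⟩
    have h1 := claim w []
    have h2 : ‖rep (wordProd A w • (Submodule.Quotient.mk v : V ⧸ U))‖ ≤ max C' 0 :=
      (hC' ⟨_, ⟨w, rfl⟩, rfl⟩).trans (le_max_left _ _)
    have h3 : (1 : ℝ) ≤ ((w.length : ℝ) + 1) ^ (q + 1) := one_le_pow₀ (by simp)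
    have h4 := norm_add_le_of_le h1 h2
    simp only [wordProd_nil, one_smul, sub_add_cancel, List.length_nil, Nat.cast_zero,
      zero_add] at h4
    have h5 : max C' 0 ≤ max C' 0 * ((w.length : ℝ) + 1) ^ (q + 1) :=
      le_mul_of_one_le_right (le_max_right _ _) h3
    calc _ ≤ _ := h4
      _ ≤ _ := by rw [add_mul]; rw [pow_succ'] at h5 ⊢; linarith

end Filtration


/-! ### Words with polynomially growing products -/

section Pumping

open Polynomial

/-- Natural numbers are central, so evaluation at them is multiplicative although R is not
commutative. -/
theorem eval_natCast_mul_noncomm {R : Type*} [Ring R] (p q : R[X]) (t : ℕ) :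
    (p * q).eval (t : R) = p.eval (t : R) * q.eval (t : R) :=
  eval₂_mul_noncomm _ _ fun _ => (Nat.cast_commute t _).symm

theorem eval_natCast_comp_C_mul_X {R : Type*} [Ring R] (p : R[X]) (a t : ℕ) :
    (p.comp (C (a : R) * X)).eval (t : R) = p.eval ((a * t : ℕ) : R) := by
  induction p using Polynomial.induction_on' with
  | add p q hp hq => simp only [add_comp, eval_add, hp, hq]
  | monomial n r =>
    have hpow : ∀ m : ℕ, ((C (a : R) * X) ^ m).eval (t : R) = ((a * t : ℕ) : R) ^ m := by
      intro m
      induction m with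
      | zero => simp
      | succ m ih =>
        rw [pow_succ, pow_succ, eval_natCast_mul_noncomm, ih, eval_natCast_mul_noncomm]
        simp
    rw [monomial_comp, eval_natCast_mul_noncomm, hpow, eval_C, eval_monomial]

/-- Expand T^n = (1 + (T - 1))^n binomially; the factor T^D kills the terms with exponent at least
D, and each remaining binomial coefficient is a polynomial in n. -/
theorem exists_polynomial_eval_eq_pow {K R : Type*} [Field K] [CharZero K] [Ring R] [Algebra K R]
    {T : R} {D : ℕ} (hT : T ^ D * (T - 1) ^ D = 0) :
    ∃ p : R[X], ∀ n : ℕ, p.eval (n : R) = T ^ (D + n) := by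
  refine ⟨∑ m ∈ Finset.range D, descPochhammer R m *
    C (algebraMap K R (m.factorial : K)⁻¹ * (T - 1) ^ m * T ^ D), fun n => ?_⟩
  have hc : Commute (T - 1) T := (Commute.refl T).sub_left (Commute.one_left T)
  have hterm : ∀ m : ℕ, (descPochhammer R m *
      C (algebraMap K R (m.factorial : K)⁻¹ * (T - 1) ^ m * T ^ D)).eval (n : R) =
      (n.choose m : R) * ((T - 1) ^ m * T ^ D) := by
    intro m
    rw [eval_natCast_mul_noncomm, descPochhammer_eval_eq_descFactorial, eval_C,
      Nat.descFactorial_eq_factorial_mul_choose, Nat.cast_mul]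
    have hm : ((m.factorial : K)) ≠ 0 := by exact_mod_cast m.factorial_ne_zero
    have h1 : (m.factorial : R) * (n.choose m : R) * algebraMap K R (m.factorial : K)⁻¹ =
        (n.choose m : R) := by
      rw [(Nat.cast_commute m.factorial (n.choose m : R)).eq, mul_assoc,
        ← map_natCast (algebraMap K R) m.factorial, ← map_mul, mul_inv_cancel₀ hm, map_one,
        mul_one]
    simp only [← mul_assoc]
    rw [h1]
  rw [eval_finsetSum, Finset.sum_congr rfl fun m _ => hterm m, pow_add]
  have hexp : T ^ n = ∑ m ∈ Finset.range (n + 1), (n.choose m : R) * (T - 1) ^ m := by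
    conv_lhs => rw [← sub_add_cancel T 1]
    rw [(Commute.one_right (T - 1)).add_pow]
    refine Finset.sum_congr rfl fun m _ => ?_
    rw [one_pow, mul_one, (Nat.cast_commute _ _).eq]
  have hvan : ∀ m, D ≤ m → (T - 1) ^ m * T ^ D = 0 := by
    intro m hm
    obtain ⟨l, rfl⟩ := Nat.exists_eq_add_of_le' hm
    rw [pow_add, mul_assoc, (hc.pow_pow D D).eq, hT, mul_zero]
  rw [← pow_add, add_comm, pow_add, hexp, Finset.sum_mul]
  simp only [mul_assoc]
  rcases le_total D (n + 1) with h | h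
  · refine Finset.sum_subset (Finset.range_mono h) fun m _ hm => ?_
    rw [hvan m (by simpa using hm), mul_zero]
  · refine (Finset.sum_subset (Finset.range_mono h) fun m _ hm => ?_).symm
    rw [Nat.choose_eq_zero_of_lt (by simpa using hm), Nat.cast_zero, zero_mul]

theorem exists_sum_pow_smul_ne_zero {K V : Type*} [Field K] [CharZero K] [AddCommGroup V]
    [Module K V] (N : ℕ) (c : ℕ → V) {i : ℕ} (hi : i < N) (hc : c i ≠ 0) :
    ∃ a : ℕ, ∑ n ∈ Finset.range N, (a : K) ^ n • c n ≠ 0 := by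
  by_contra! hcon
  refine hc ((Module.forall_dual_apply_eq_zero_iff K (c i)).1 fun f => ?_)
  let p : K[X] := ∑ n ∈ Finset.range N, monomial n (f (c n))
  have hp : p = 0 := by
    refine eq_zero_of_infinite_isRoot p
      ((Set.infinite_range_of_injective Nat.cast_injective).mono ?_)
    rintro _ ⟨a, rfl⟩
    have := congrArg f (hcon a)
    simp only [map_sum, map_smul, map_zero, smul_eq_mul] at this
    simp only [p, Set.mem_ofPred_eq, IsRoot, eval_finsetSum, eval_monomial]
    rw [← this]
    exact Finset.sum_congr rfl fun n _ => mul_comm _ _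
  have := congrArg (fun p => p.coeff i) hp
  simpa [p, finsetSum_coeff, coeff_monomial, hi] using this

variable {K R ι : Type*} [Field K] [Ring R] [Algebra K R] {A : ι → R}

/-- The lower bound, by induction on layers: prepending the family of words for layer q to powers of
a new word w raises the degree by at least 1. The coefficient statement, rather than one about
degree, is what the induction can propagate to v. -/
theorem exists_pumping [Finite ι] [IsAlgClosed K] [CharZero K]
    (hA : Submodule.span K (Set.range (wordProd A)) = ⊤) {B D : ℕ} (hB : B ≠ 0)
    (hH : ∀ w, wordProd A w ^ D * (wordProd A w ^ B - 1) ^ D = 0)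
    (V : Type*) [AddCommGroup V] [Module K V] [Module R V] [IsScalarTower K R V]
    [FiniteDimensional K V] (q : ℕ) :
    ∀ v ∉ filtration hA V q, ∃ (Y : ℕ → List ι) (α β : ℕ) (p : R[X]) (j : ℕ),
      (∀ t, (Y t).length = α * t + β) ∧ (∀ t : ℕ, wordProd A (Y t) = p.eval (t : R)) ∧
      q ≤ j ∧ p.coeff j • v ≠ 0 := by
  induction q with
  | zero =>
    intro v hv
    refine ⟨fun _ => [], 0, 0, 1, 0, by simp, by simp, le_rfl, ?_⟩
    rw [filtration_zero, Submodule.mem_bot] at hv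
    simpa using hv
  | succ q ih =>
    intro v hv
    rw [mem_filtration_succ] at hv
    obtain ⟨w, x, hwx⟩ := exists_pow_smul_ne_of_notMem_finiteOrbits hA hv (B * D) hB
    set T := wordProd A w ^ B with hTdef
    have hT : T ^ D * (T - 1) ^ D = 0 := by
      obtain ⟨B, rfl⟩ := Nat.exists_eq_succ_of_ne_zero hB
      rw [hTdef, ← pow_mul, Nat.succ_mul, pow_add, mul_assoc, hH, mul_zero]
    obtain ⟨P, hP⟩ := exists_polynomial_eval_eq_pow (K := K) hT
    set v' := wordProd A x • v with hv'
    -- T^(D+1) - T^D = P(1) - P(0) is the sum of the coefficients of positive index, so not all of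
    -- them can send v' into F_q.
    obtain ⟨i, hi⟩ : ∃ i, i ≠ 0 ∧ P.coeff i • v' ∉ filtration hA V q := by
      by_contra! hcon
      apply hwx
      have h0 : T ^ D = P.coeff 0 := by
        rw [coeff_zero_eq_eval_zero]; simpa using (hP 0).symm
      have h1 : T ^ (D + 1) = ∑ i ∈ Finset.range (P.natDegree + 1), P.coeff i := by
        rw [← hP 1, eval_eq_sum_range]; simp
      rw [pow_add, pow_mul, ← hTdef, ← pow_succ, ← Submodule.Quotient.mk_smul,
        ← Submodule.Quotient.mk_smul, ← Submodule.Quotient.mk_smul, Submodule.Quotient.eq,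
        ← hv', h0, h1, Finset.sum_range_succ', add_smul, add_sub_cancel_right, Finset.sum_smul]
      exact Submodule.sum_mem _ fun i _ => hcon _ i.succ_ne_zero
    obtain ⟨Y, α, β, p, j, hlen, hY, hj, hne⟩ := ih _ hi.2
    -- With w^B repeated D + a t times, the coefficient of index j + i applied to v is a polynomial
    -- in a whose coefficient at a^i is nonzero; a suitable a excludes cancellation.
    obtain ⟨a, ha⟩ := exists_sum_pow_smul_ne_zero (K := K) (j + i + 1)
      (fun n => p.coeff (j + i - n) • P.coeff n • v') (i := i) (by omega) (by simpa using hne)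
    refine ⟨fun t => Y t ++ (List.replicate (B * (D + a * t)) w).flatten ++ x,
      α + B * a * w.length, β + B * D * w.length + x.length,
      p * P.comp (C (a : R) * X) * C (wordProd A x), j + i, ?_, ?_, by omega, ?_⟩
    · intro t
      simp only [List.length_append, hlen, List.length_flatten, List.map_replicate,
        List.sum_replicate, smul_eq_mul]
      ring
    · intro t
      rw [wordProd_append, wordProd_append, wordProd_flatten_replicate,
        eval_natCast_mul_noncomm, eval_natCast_mul_noncomm, eval_natCast_comp_C_mul_X, hP, hY,
        eval_C, pow_mul]
    · rw [coeff_mul_C, mul_smul, ← hv', coeff_mul, ← Finset.Nat.sum_antidiagonal_swap,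
        Finset.Nat.sum_antidiagonal_eq_sum_range_succ_mk, Finset.sum_smul]
      convert ha using 1
      refine Finset.sum_congr rfl fun n _ => ?_
      simp only [Prod.fst_swap, Prod.snd_swap, comp_C_mul_X_coeff]
      rw [← Nat.cast_pow, (Nat.cast_commute _ _).symm.eq, ← mul_assoc,
        ← (Nat.cast_commute _ (p.coeff _)).eq, mul_assoc, mul_smul, mul_smul, ← Nat.cast_pow,
        Nat.cast_smul_eq_nsmul, Nat.cast_smul_eq_nsmul]

end Pumping


/-! ### Two-sided polynomial growth in a spanned algebra -/

section NormedAlgebra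

open Polynomial

/-- The leading term, of degree m ≥ j ≥ k, is at least twice the sum of the others once t is large.
-/
theorem eventually_pow_le_norm_eval {R : Type*} [NormedRing R] [NormedAlgebra ℝ R] {p : R[X]}
    {j k : ℕ} (hj : p.coeff j ≠ 0) (hkj : k ≤ j) :
    ∃ c : ℝ, 0 < c ∧ ∀ᶠ t : ℕ in atTop, c * (t : ℝ) ^ k ≤ ‖p.eval (t : R)‖ := by
  set m := p.natDegree
  have hm : 0 < ‖p.coeff m‖ := by
    rw [norm_pos_iff, coeff_natDegree]
    exact leadingCoeff_ne_zero.2 fun h => hj (by simp [h])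
  have hkm : k ≤ m := hkj.trans (le_natDegree_of_ne_zero hj)
  set S := ∑ i ∈ Finset.range m, ‖p.coeff i‖
  have hterm : ∀ i t : ℕ, ‖p.coeff i * (t : R) ^ i‖ = (t : ℝ) ^ i * ‖p.coeff i‖ := by
    intro i t
    rw [← Nat.cast_pow, (Nat.cast_commute _ _).symm.eq, ← nsmul_eq_mul,
      ← Nat.cast_smul_eq_nsmul ℝ, norm_smul]
    simp
  refine ⟨‖p.coeff m‖ / 2, by positivity, ?_⟩
  filter_upwards [eventually_ge_atTop 1, eventually_ge_atTop ⌈2 * S / ‖p.coeff m‖⌉₊] with t ht1 ht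
  have ht1' : (1 : ℝ) ≤ t := by exact_mod_cast ht1
  have hS : 2 * S ≤ t * ‖p.coeff m‖ := by
    rw [← div_le_iff₀ hm]; exact Nat.ceil_le.1 ht
  have hlow : t * ∑ i ∈ Finset.range m, (t : ℝ) ^ i * ‖p.coeff i‖ ≤ (t : ℝ) ^ m * S := by
    rw [Finset.mul_sum, Finset.mul_sum]
    refine Finset.sum_le_sum fun i hi => ?_
    rw [← mul_assoc, ← pow_succ']
    gcongr
    · simpa using hi
  have hsum : (t : ℝ) ^ m * ‖p.coeff m‖ ≤
      ‖p.eval (t : R)‖ + ∑ i ∈ Finset.range m, (t : ℝ) ^ i * ‖p.coeff i‖ := by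
    rw [← hterm, eval_eq_sum_range, Finset.sum_range_succ]
    have h1 := norm_sub_le
      (∑ i ∈ Finset.range m, p.coeff i * (t : R) ^ i + p.coeff m * (t : R) ^ m)
      (∑ i ∈ Finset.range m, p.coeff i * (t : R) ^ i)
    rw [add_sub_cancel_left] at h1
    refine h1.trans (add_le_add le_rfl ((norm_sum_le _ _).trans (le_of_eq ?_)))
    exact Finset.sum_congr rfl fun i _ => hterm i t
  have hpow : (t : ℝ) ^ k ≤ (t : ℝ) ^ m := pow_le_pow_right₀ ht1' hkm
  have hfin : t * (‖p.coeff m‖ / 2 * (t : ℝ) ^ m) ≤ t * ‖p.eval (t : R)‖ := by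
    have h2 : (t : ℝ) ^ m * (2 * S) ≤ (t : ℝ) ^ m * (t * ‖p.coeff m‖) := by gcongr
    have h3 := mul_le_mul_of_nonneg_left hsum (by positivity : (0 : ℝ) ≤ t)
    linarith
  exact (mul_le_mul_of_nonneg_left hpow (by positivity)).trans
    (le_of_mul_le_mul_left hfin (by positivity))

/-- Apply the filtration to R as a module over itself: the orbit of 1 consists of the word products.
-/
theorem exists_polynomial_growth {R ι : Type*} [NormedRing R] [NormedAlgebra ℂ R]
    [FiniteDimensional ℂ R] [Nontrivial R] [Finite ι] {A : ι → R}
    (hA : Submodule.span ℂ (Set.range (wordProd A)) = ⊤) {B D : ℕ} (hB : B ≠ 0)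
    (hH : ∀ w, wordProd A w ^ D * (wordProd A w ^ B - 1) ^ D = 0) :
    ∃ k : ℕ, (∃ C : ℝ, ∀ w, ‖wordProd A w‖ ≤ C * ((w.length : ℝ) + 1) ^ k) ∧
      ∃ (Y : ℕ → List ι) (α β : ℕ) (c : ℝ), 0 < c ∧ (∀ t, (Y t).length = α * t + β) ∧
        ∀ᶠ t : ℕ in atTop, c * (t : ℝ) ^ k ≤ ‖wordProd A (Y t)‖ := by
  classical
  have hP : (X ^ D * (X ^ B - 1) ^ D : ℂ[X]) ≠ 0 :=
    mul_ne_zero (pow_ne_zero _ X_ne_zero) (pow_ne_zero _ (X_pow_sub_C_ne_zero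
      (Nat.pos_of_ne_zero hB) (1 : ℂ)))
  have hex : ∃ q, (1 : R) ∈ filtration hA R q := by
    obtain ⟨q, hq⟩ := exists_filtration_eq_top hA R hP fun w => by simpa using hH w
    exact ⟨q, hq ▸ Submodule.mem_top⟩
  obtain ⟨k, hk⟩ : ∃ k, Nat.find hex = k + 1 := by
    refine Nat.exists_eq_succ_of_ne_zero fun h0 => ?_
    have := Nat.find_spec hex
    rw [h0, filtration_zero, Submodule.mem_bot] at this
    exact one_ne_zero this
  have h1 : (1 : R) ∈ filtration hA R (k + 1) := hk ▸ Nat.find_spec hex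
  have h2 : (1 : R) ∉ filtration hA R k := Nat.find_min hex (by omega)
  refine ⟨k, ?_, ?_⟩
  · obtain ⟨C, hC⟩ := exists_norm_smul_le_of_mem_filtration hA R k 1 h1
    exact ⟨C, fun w => by simpa using hC w⟩
  · obtain ⟨Y, α, β, p, j, hlen, hY, hkj, hj⟩ := exists_pumping hA hB hH R k 1 h2
    let _ : NormedAlgebra ℝ R := NormedAlgebra.restrictScalars ℝ ℂ R
    obtain ⟨c, hc, hev⟩ := eventually_pow_le_norm_eval (by simpa using hj) hkj
    exact ⟨Y, α, β, c, hc, hlen, hev.mono fun t ht => by rwa [hY]⟩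

end NormedAlgebra

/-! ### Submultiplicative sequences -/

section Sequences

variable {m : ℕ → ℝ} {c C : ℝ}

/-- Fekete's lemma for log C + log m; the limit is an infimum, which gives the final inequality. -/
theorem exists_tendsto_log_div (hc : 0 < c) (hcm : ∀ n, c ≤ m n) (hC : 0 < C)
    (hsub : ∀ a b, m (a + b) ≤ C * m a * m b) :
    ∃ L : ℝ, 0 ≤ L ∧ Tendsto (fun n : ℕ => Real.log (m n) / n) atTop (𝓝 L) ∧
      ∀ n : ℕ, L * n ≤ Real.log C + Real.log (m n) := by
  have hm : ∀ n, 0 < m n := fun n => hc.trans_le (hcm n)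
  let u : ℕ → ℝ := fun n => Real.log C + Real.log (m n)
  have hu : Subadditive u := by
    intro a b
    have h1 := Real.log_le_log (hm _) (hsub a b)
    rw [Real.log_mul (by have := hm a; positivity) (hm b).ne',
      Real.log_mul hC.ne' (hm a).ne'] at h1
    simp only [u]
    linarith
  have hlow : ∀ n, Real.log C + Real.log c ≤ u n := fun n =>
    add_le_add le_rfl (Real.log_le_log hc (hcm n))
  have hbdd : BddBelow (Set.range fun n : ℕ => u n / n) := by
    refine ⟨-|Real.log C + Real.log c|, ?_⟩
    rintro _ ⟨n, rfl⟩
    rcases n.eq_zero_or_pos with rfl | hn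
    · simp
    have hn' : (1 : ℝ) ≤ n := by exact_mod_cast hn
    have h2 := hlow n
    have h3 := neg_abs_le (Real.log C + Real.log c)
    have h4 : |Real.log C + Real.log c| ≤ |Real.log C + Real.log c| * n :=
      le_mul_of_one_le_right (abs_nonneg _) hn'
    simp only
    rw [le_div_iff₀ (by linarith)]
    linarith
  have hlim := hu.tendsto_lim hbdd
  have hconst : ∀ x : ℝ, Tendsto (fun n : ℕ => x / (n : ℝ)) atTop (𝓝 0) := fun x =>
    tendsto_const_div_atTop_nhds_zero_nat x
  refine ⟨hu.lim, ?_, ?_, ?_⟩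
  · have h := hlim.sub (hconst (Real.log C + Real.log c))
    rw [sub_zero] at h
    refine ge_of_tendsto' h fun n => ?_
    rw [← sub_div]
    exact div_nonneg (by linarith [hlow n]) (Nat.cast_nonneg n)
  · have := hlim.sub (hconst (Real.log C))
    rw [sub_zero] at this
    refine this.congr fun n => ?_
    simp only [u]
    rw [← sub_div, add_sub_cancel_left]
  · intro n
    rcases n.eq_zero_or_pos with rfl | hn
    · have h0 := hu 0 0
      simp only [u, add_zero] at h0
      simp only [Nat.cast_zero, mul_zero]
      linarith
    · rw [← le_div_iff₀ (by exact_mod_cast hn)]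
      exact hu.lim_le_div hbdd hn.ne'

theorem tendsto_rpow_of_tendsto_log_div (hm : ∀ n, 0 < m n) {L : ℝ}
    (hL : Tendsto (fun n : ℕ => Real.log (m n) / n) atTop (𝓝 L)) :
    Tendsto (fun n : ℕ => m n ^ (1 / (n : ℝ))) atTop (𝓝 (Real.exp L)) := by
  refine ((Real.continuous_exp.tendsto L).comp hL).congr fun n => ?_
  rw [Real.rpow_def_of_pos (hm n)]
  simp [div_eq_mul_inv]

theorem tendsto_log_div_log_atTop {L a : ℝ} (hL : 0 < L)
    (h : ∀ n : ℕ, L * n ≤ a + Real.log (m n)) :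
    Tendsto (fun n : ℕ => Real.log (m n) / Real.log n) atTop atTop := by
  have hlog : Tendsto (fun n : ℕ => Real.log n) atTop atTop :=
    Real.tendsto_log_atTop.comp tendsto_natCast_atTop_atTop
  have h1 : Tendsto (fun n : ℕ => (n : ℝ) / Real.log n) atTop atTop := by
    have h2 : Tendsto (fun x : ℝ => Real.log x / x) atTop (𝓝[>] 0) := by
      refine tendsto_nhdsWithin_iff.2 ⟨?_, ?_⟩
      · simpa using Real.isLittleO_log_id_atTop.tendsto_div_nhds_zero
      · filter_upwards [eventually_gt_atTop 1] with x hx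
        exact div_pos (Real.log_pos hx) (by linarith)
    refine (h2.inv_tendsto_nhdsGT_zero.comp tendsto_natCast_atTop_atTop).congr fun n => ?_
    simp
  have h3 : Tendsto (fun n : ℕ => L * ((n : ℝ) / Real.log n) - a / Real.log n) atTop atTop := by
    have := (h1.const_mul_atTop hL).atTop_add ((hlog.const_div_atTop a).neg)
    simpa [sub_eq_add_neg] using this
  refine tendsto_atTop_mono' _ ?_ h3
  filter_upwards [eventually_gt_atTop 1] with n hn
  have hpos : 0 < Real.log n := Real.log_pos (by exact_mod_cast hn)
  rw [← mul_div_assoc, ← sub_div]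
  gcongr
  linarith [h n]

theorem tendsto_log_div_log_of_pow_bounds {C₁ C₂ : ℝ} (hC₁ : 0 < C₁) (hC₂ : 0 < C₂) {k : ℕ}
    (h : ∀ n : ℕ, 1 ≤ n → C₁ * (n : ℝ) ^ k ≤ m n ∧ m n ≤ C₂ * (n : ℝ) ^ k) :
    Tendsto (fun n : ℕ => Real.log (m n) / Real.log n) atTop (𝓝 (k : ℝ)) := by
  have hlog : Tendsto (fun n : ℕ => Real.log n) atTop atTop :=
    Real.tendsto_log_atTop.comp tendsto_natCast_atTop_atTop
  have hlim : ∀ a : ℝ, Tendsto (fun n : ℕ => a / Real.log n + k) atTop (𝓝 (k : ℝ)) := fun a => by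
    simpa using (hlog.const_div_atTop a).add_const (k : ℝ)
  refine tendsto_of_tendsto_of_tendsto_of_le_of_le' (hlim (Real.log C₁)) (hlim (Real.log C₂)) ?_ ?_
  all_goals
    filter_upwards [eventually_gt_atTop 1] with n hn
    have hpos : 0 < Real.log n := Real.log_pos (by exact_mod_cast hn)
    have hn0 : (0 : ℝ) < n := by exact_mod_cast (by omega : 0 < n)
    obtain ⟨h1, h2⟩ := h n hn.le
    have hm : 0 < m n := lt_of_lt_of_le (by positivity) h1
    have e : ∀ c : ℝ, 0 < c →
        Real.log c / Real.log n + k = Real.log (c * (n : ℝ) ^ k) / Real.log n := by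
      intro c hc
      rw [Real.log_mul hc.ne' (by positivity), Real.log_pow]
      field_simp
  · rw [e C₁ hC₁]
    gcongr
  · rw [e C₂ hC₂]
    gcongr

/-- The lower bound is known only along α t + β. Given n, write α t + β = n + r with r bounded and
use m (n + r) ≤ C * m n * K. -/
theorem exists_pow_bounds (hc : 0 < c) (hcm : ∀ n, c ≤ m n) (hC : 0 < C)
    (hsub : ∀ a b, m (a + b) ≤ C * m a * m b) {k : ℕ} {C' : ℝ}
    (hub : ∀ n : ℕ, m n ≤ C' * ((n : ℝ) + 1) ^ k) {α β : ℕ} {c' : ℝ} (hc' : 0 < c')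
    (hlb : ∀ᶠ t : ℕ in atTop, c' * (t : ℝ) ^ k ≤ m (α * t + β)) :
    ∃ C₁ C₂ : ℝ, 0 < C₁ ∧ 0 < C₂ ∧
      ∀ n : ℕ, 1 ≤ n → C₁ * (n : ℝ) ^ k ≤ m n ∧ m n ≤ C₂ * (n : ℝ) ^ k := by
  have hm : ∀ n, 0 < m n := fun n => hc.trans_le (hcm n)
  have hC'0 : 0 < C' := by simpa using (hm 0).trans_le (hub 0)
  have hupper : ∀ n : ℕ, 1 ≤ n → m n ≤ C' * 2 ^ k * (n : ℝ) ^ k := by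
    intro n hn
    have hn' : (1 : ℝ) ≤ n := by exact_mod_cast hn
    refine (hub n).trans ?_
    rw [mul_assoc, ← mul_pow]
    gcongr
    linarith
  suffices hlower : ∃ C₁ : ℝ, 0 < C₁ ∧ ∀ n : ℕ, 1 ≤ n → C₁ * (n : ℝ) ^ k ≤ m n by
    obtain ⟨C₁, h0, h1⟩ := hlower
    exact ⟨C₁, C' * 2 ^ k, h0, by positivity, fun n hn => ⟨h1 n hn, hupper n hn⟩⟩
  -- For k = 0 the step α may vanish, but c is already a lower bound.
  rcases k.eq_zero_or_pos with rfl | hk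
  · exact ⟨c, hc, fun n _ => by simpa using hcm n⟩
  have hα : 0 < α := by
    by_contra h0
    have h0 : α = 0 := by omega
    have ht : Tendsto (fun t : ℕ => c' * (t : ℝ) ^ k) atTop atTop :=
      ((tendsto_pow_atTop hk.ne').comp tendsto_natCast_atTop_atTop).const_mul_atTop hc'
    obtain ⟨t, ht1, ht2⟩ := (hlb.and (ht.eventually_gt_atTop (m β))).exists
    rw [h0, zero_mul, zero_add] at ht1
    linarith
  obtain ⟨t₀, ht₀⟩ := eventually_atTop.1 hlb
  obtain ⟨K, hK⟩ := ((Finset.range (α * (t₀ + 1) + β + 1)).image m).bddAbove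
  have hK' : ∀ r, r ≤ α * (t₀ + 1) + β → m r ≤ K := fun r hr =>
    hK (by simp only [Finset.coe_image, Set.mem_image]
           exact ⟨r, by simpa using Nat.lt_succ_of_le hr, rfl⟩)
  have hK0 : 0 < K := (hm 0).trans_le (hK' 0 (Nat.zero_le _))
  refine ⟨c' / (α ^ k * C * K), by positivity, fun n _ => ?_⟩
  -- The 1 rounds the quotient up, so that n ≤ α t; t₀ puts t in the range where the lower bound
  -- holds.
  set t := n / α + t₀ + 1 with ht
  have hdiv : α * (n / α) + n % α = n := Nat.div_add_mod n α
  have hmod : n % α < α := Nat.mod_lt _ hα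
  have hnt : n ≤ α * t := by
    rw [ht, mul_add, mul_add]; omega
  obtain ⟨r, hr⟩ := Nat.exists_eq_add_of_le (hnt.trans (Nat.le_add_right (α * t) β))
  have hrle : r ≤ α * (t₀ + 1) + β := by
    have : α * t = α * (n / α) + α * (t₀ + 1) := by rw [ht]; ring
    omega
  have h1 := ht₀ t (by rw [ht]; linarith [Nat.zero_le (n / α)])
  rw [hr] at h1
  have h2 : (n : ℝ) ^ k ≤ α ^ k * (t : ℝ) ^ k := by
    rw [← mul_pow]
    gcongr
    exact_mod_cast hnt
  have h3 : c' * (t : ℝ) ^ k ≤ C * m n * K :=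
    h1.trans ((hsub n r).trans
      (mul_le_mul_of_nonneg_left (hK' r hrle) (by have := hm n; positivity)))
  rw [div_mul_eq_mul_div, div_le_iff₀ (by positivity)]
  calc c' * (n : ℝ) ^ k ≤ c' * (α ^ k * (t : ℝ) ^ k) := by gcongr
    _ = α ^ k * (c' * (t : ℝ) ^ k) := by ring
    _ ≤ α ^ k * (C * m n * K) := by gcongr
    _ = m n * (α ^ k * C * K) := by ring

end Sequences


/-! ### Generated algebras, Cayley–Hamilton and Kronecker's theorem -/

section Spectrum

open Polynomial

theorem span_range_wordProd_adjoin {K S ι : Type*} [Field K] [Ring S] [Algebra K S] (a : ι → S) :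
    Submodule.span K (Set.range (wordProd fun i =>
      (⟨a i, Algebra.subset_adjoin ⟨i, rfl⟩⟩ : Algebra.adjoin K (Set.range a)))) = ⊤ := by
  set b : ι → Algebra.adjoin K (Set.range a) := fun i => ⟨a i, Algebra.subset_adjoin ⟨i, rfl⟩⟩
  have hb : ∀ w, ((wordProd b w : Algebra.adjoin K (Set.range a)) : S) = wordProd a w := by
    intro w
    induction w with
    | nil => simp
    | cons i w ih => simp [ih, b]
  have key : ∀ x ∈ Submodule.span K (Submonoid.closure (Set.range a) : Set S),
      ∃ y ∈ Submodule.span K (Set.range (wordProd b)), (y : S) = x := by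
    intro x hx
    induction hx using Submodule.span_induction with
    | mem x hx =>
      rw [← FreeMonoid.mrange_lift] at hx
      obtain ⟨w, rfl⟩ := hx
      exact ⟨_, Submodule.subset_span ⟨w.toList, rfl⟩, by rw [hb, FreeMonoid.lift_apply]; rfl⟩
    | zero => exact ⟨0, zero_mem _, rfl⟩
    | add x y _ _ hx hy =>
      obtain ⟨x', hx', rfl⟩ := hx
      obtain ⟨y', hy', rfl⟩ := hy
      exact ⟨_, add_mem hx' hy', rfl⟩
    | smul c x _ hx =>
      obtain ⟨x', hx', rfl⟩ := hx
      exact ⟨_, Submodule.smul_mem _ c hx', rfl⟩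
  refine eq_top_iff.2 fun x _ => ?_
  have hx : (x : S) ∈ Submodule.span K (Submonoid.closure (Set.range a) : Set S) := by
    rw [← Algebra.adjoin_eq_span]; exact x.2
  obtain ⟨y, hy, hyx⟩ := key _ hx
  rwa [← Subtype.ext hyx]

theorem wordProd_map {S T ι : Type*} [Ring S] [Ring T] (f : S →+* T) (A : ι → S) (w : List ι) :
    f (wordProd A w) = wordProd (fun i => f (A i)) w := by
  induction w with
  | nil => simp
  | cons i w ih => simp [ih]

theorem exists_polynomial_growth_of_pow_mul_pow_eq_zero {S ι : Type*} [NormedRing S]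
    [NormedAlgebra ℂ S] [FiniteDimensional ℂ S] [Nontrivial S] [Finite ι] (a : ι → S) {B D : ℕ}
    (hB : B ≠ 0) (hH : ∀ w, wordProd a w ^ D * (wordProd a w ^ B - 1) ^ D = 0) :
    ∃ k : ℕ, (∃ C : ℝ, ∀ w, ‖wordProd a w‖ ≤ C * ((w.length : ℝ) + 1) ^ k) ∧
      ∃ (Y : ℕ → List ι) (α β : ℕ) (c : ℝ), 0 < c ∧ (∀ t, (Y t).length = α * t + β) ∧
        ∀ᶠ t : ℕ in atTop, c * (t : ℝ) ^ k ≤ ‖wordProd a (Y t)‖ := by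
  let R := Algebra.adjoin ℂ (Set.range a)
  let b : ι → R := fun i => ⟨a i, Algebra.subset_adjoin ⟨i, rfl⟩⟩
  have hb : ∀ w, ((wordProd b w : R) : S) = wordProd a w := fun w =>
    wordProd_map (R.val : R →+* S) b w
  have hnorm : ∀ w, ‖wordProd b w‖ = ‖wordProd a w‖ := fun w => congrArg norm (hb w)
  have hHb : ∀ w, wordProd b w ^ D * (wordProd b w ^ B - 1) ^ D = 0 := fun w =>
    Subtype.ext (by simpa [hb] using hH w)
  have h := exists_polynomial_growth (A := b) (span_range_wordProd_adjoin a) hB hHb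
  simpa only [hnorm] using h

/-- Each of the d linear factors of the characteristic polynomial divides X (X^B - 1); conclude by
Cayley–Hamilton. -/
theorem pow_mul_pow_sub_one_pow_eq_zero {K : Type*} [Field K] [IsAlgClosed K] {d B : ℕ}
    (M : Matrix (Fin d) (Fin d) K) (h : ∀ z ∈ M.charpoly.roots, z = 0 ∨ z ^ B = 1) :
    M ^ d * (M ^ B - 1) ^ d = 0 := by
  have hs := IsAlgClosed.splits M.charpoly
  have hdvd : M.charpoly ∣ (X * (X ^ B - 1)) ^ d := by
    rw [hs.eq_prod_roots_of_monic M.charpoly_monic]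
    have hcard : M.charpoly.roots.card = d := by
      rw [← hs.natDegree_eq_card_roots, Matrix.charpoly_natDegree_eq_dim, Fintype.card_fin]
    have h1 : (M.charpoly.roots.map fun z => X - C z).prod ∣
        (M.charpoly.roots.map fun _ => (X * (X ^ B - 1) : K[X])).prod := by
      refine Multiset.prod_dvd_prod_of_dvd _ _ fun z hz => ?_
      rw [dvd_iff_isRoot]
      rcases h z hz with rfl | h1
      · simp
      · simp [h1]
    simpa [hcard] using h1
  obtain ⟨q, hq⟩ := hdvd
  have h2 := congrArg (aeval M) hq
  rw [map_mul, Matrix.aeval_self_charpoly, zero_mul] at h2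
  have hc : Commute M (M ^ B - 1) :=
    ((Commute.refl M).pow_right B).sub_right (Commute.one_right M)
  rw [← hc.mul_pow]
  simpa using h2

theorem pow_mem_roots_charpoly {K : Type*} [Field K] {d : ℕ} {M : Matrix (Fin d) (Fin d) K} {z : K}
    (hz : z ∈ M.charpoly.roots) (n : ℕ) : z ^ n ∈ (M ^ n).charpoly.roots := by
  have h1 : z ∈ spectrum K M :=
    Matrix.mem_spectrum_iff_isRoot_charpoly.2 (isRoot_of_mem_roots hz)
  exact (mem_roots (Matrix.charpoly_monic _).ne_zero).2
    (Matrix.mem_spectrum_iff_isRoot_charpoly.1 (spectrum.pow_mem_pow M n h1))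

/-- Kronecker's theorem, uniformly in the matrix: a family of integer matrices that is closed
under powers and has its spectra in the closed unit disc has its nonzero eigenvalues among the
roots of unity of one order. -/
theorem exists_pow_eq_one_of_norm_roots_le {d : ℕ} (F : Set (Matrix (Fin d) (Fin d) ℤ))
    (hpow : ∀ M ∈ F, ∀ n : ℕ, M ^ n ∈ F)
    (hF : ∀ M ∈ F, ∀ z ∈ (M.map (Int.cast : ℤ → ℂ)).charpoly.roots, ‖z‖ ≤ 1) :
    ∃ B : ℕ, B ≠ 0 ∧ ∀ M ∈ F, ∀ z ∈ (M.map (Int.cast : ℤ → ℂ)).charpoly.roots,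
      z = 0 ∨ z ^ B = 1 := by
  classical
  have hmap : ∀ M : Matrix (Fin d) (Fin d) ℤ,
      (M.map (Int.cast : ℤ → ℂ)).charpoly = M.charpoly.map (Int.castRingHom ℂ) := fun M =>
    Matrix.charpoly_map M (Int.castRingHom ℂ)
  set E : Set ℂ := {z | ∃ M ∈ F, z ∈ (M.map (Int.cast : ℤ → ℂ)).charpoly.roots}
  -- Roots in the unit disc bound the integer coefficients by binomial coefficients, leaving
  -- finitely many characteristic polynomials.
  have hE : E.Finite := by
    refine (bUnion_roots_finite (Int.castRingHom ℂ) d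
      (Set.finite_Icc (-(d.choose (d / 2) : ℤ)) (d.choose (d / 2)))).subset ?_
    rintro z ⟨M, hM, hz⟩
    rw [hmap] at hz
    have hdeg : M.charpoly.natDegree ≤ d := by
      rw [Matrix.charpoly_natDegree_eq_dim, Fintype.card_fin]
    simp only [Set.mem_iUnion]
    refine ⟨M.charpoly, ⟨hdeg, fun i => ?_⟩, by simpa using hz⟩
    have h1 := coeff_bdd_of_roots_le (B := 1) (Int.castRingHom ℂ) M.charpoly_monic
      (IsAlgClosed.splits _) hdeg (by rw [← hmap]; exact hF M hM) i
    rw [coeff_map, eq_intCast, Complex.norm_intCast, max_self, one_pow,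
      one_mul] at h1
    rw [Set.mem_Icc, ← abs_le]
    exact_mod_cast h1
  have hEpow : ∀ z ∈ E, ∀ n : ℕ, z ^ n ∈ E := by
    rintro z ⟨M, hM, hz⟩ n
    refine ⟨M ^ n, hpow M hM n, ?_⟩
    have : (M ^ n).map (Int.cast : ℤ → ℂ) = M.map (Int.cast : ℤ → ℂ) ^ n :=
      map_pow (Int.castRingHom ℂ).mapMatrix M n
    rw [this]
    exact pow_mem_roots_charpoly hz n
  -- The powers of z stay in the finite set E, so two of them coincide.
  have hroot : ∀ z : ℂ, ∃ b : ℕ, b ≠ 0 ∧ (z ∈ E → z = 0 ∨ z ^ b = 1) := by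
    intro z
    by_cases hz : z ∈ E
    · have := hE.to_subtype
      obtain ⟨i, j, hij, h⟩ := Finite.exists_ne_map_eq_of_infinite
        fun n : ℕ => (⟨z ^ n, hEpow z hz n⟩ : E)
      wlog hlt : i < j generalizing i j
      · exact this j i hij.symm h.symm (by omega)
      have h' : z ^ i = z ^ j := congrArg Subtype.val h
      refine ⟨j - i, by omega, fun _ => ?_⟩
      by_cases h0 : z = 0
      · exact Or.inl h0
      · right
        have : z ^ i * z ^ (j - i) = z ^ i * 1 := by
          rw [← pow_add, Nat.add_sub_cancel' hlt.le, mul_one, h']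
        exact mul_left_cancel₀ (pow_ne_zero _ h0) this
    · exact ⟨1, one_ne_zero, fun h => absurd h hz⟩
  choose b hb0 hb using hroot
  refine ⟨∏ z ∈ hE.toFinset, b z, Finset.prod_ne_zero_iff.2 fun z _ => hb0 z,
    fun M hM z hz => ?_⟩
  have hzE : z ∈ E := ⟨M, hM, hz⟩
  refine (hb z hzE).imp id fun h => ?_
  obtain ⟨c, hc⟩ := Finset.dvd_prod_of_mem b (hE.mem_toFinset.2 hzE)
  rw [hc, pow_mul, h, one_pow]

end Spectrum

/-! ### Equivalence of norms -/

section NormComparison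

theorem exists_seminorm_bounds {𝕜 E F : Type*} [RCLike 𝕜] [AddCommGroup E] [Module 𝕜 E]
    [NormedAddCommGroup F] [NormedSpace 𝕜 F] [FiniteDimensional 𝕜 F] (e : E ≃ₗ[𝕜] F)
    (N : Seminorm 𝕜 E) (hN : ∀ x, N x = 0 → x = 0) :
    ∃ c C : ℝ, 0 < c ∧ 0 < C ∧ ∀ x, c * ‖e x‖ ≤ N x ∧ N x ≤ C * ‖e x‖ := by
  let _ : Norm E := ⟨N⟩
  have core : NormedSpace.Core 𝕜 E :=
    { norm_nonneg := fun x => apply_nonneg N x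
      norm_smul := fun c x => map_smul_eq_mul N c x
      norm_triangle := fun x y => map_add_le_add N x y
      norm_eq_zero_iff := fun x => ⟨hN x, fun h => by rw [h]; exact map_zero N⟩ }
  let _ : NormedAddCommGroup E := NormedAddCommGroup.ofCore core
  let _ : NormedSpace 𝕜 E := NormedSpace.ofCore core
  have : FiniteDimensional 𝕜 E := e.symm.finiteDimensional
  obtain ⟨C₁, hC₁, h₁⟩ := (LinearMap.toContinuousLinearMap e.toLinearMap).bound
  obtain ⟨C₂, hC₂, h₂⟩ := (LinearMap.toContinuousLinearMap e.symm.toLinearMap).bound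
  refine ⟨C₁⁻¹, C₂, inv_pos.2 hC₁, hC₂, fun x => ⟨?_, ?_⟩⟩
  · rw [inv_mul_le_iff₀ hC₁]
    exact h₁ x
  · have := h₂ (e x)
    rwa [LinearMap.coe_toContinuousLinearMap', LinearEquiv.coe_coe, e.symm_apply_apply] at this

/-- The integer sup norm does not depend on 𝕜, so it mediates between the given norm and a complex
operator norm. -/
theorem exists_seminorm_bounds_intMatrix {𝕜 : Type*} [RCLike 𝕜] {d : ℕ}
    (N : Seminorm 𝕜 (Matrix (Fin d) (Fin d) 𝕜)) (hN : ∀ M, N M = 0 → M = 0) :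
    ∃ c C : ℝ, 0 < c ∧ 0 < C ∧ ∀ M : Matrix (Fin d) (Fin d) ℤ,
      c * ‖(fun i j => M i j : Fin d → Fin d → ℤ)‖ ≤ N (M.map (Int.cast : ℤ → 𝕜)) ∧
      N (M.map (Int.cast : ℤ → 𝕜)) ≤ C * ‖(fun i j => M i j : Fin d → Fin d → ℤ)‖ := by
  obtain ⟨c, C, hc, hC, h⟩ := exists_seminorm_bounds (Matrix.ofLinearEquiv 𝕜).symm N hN
  refine ⟨c, C, hc, hC, fun M => ?_⟩
  have he : ‖(Matrix.ofLinearEquiv 𝕜).symm (M.map (Int.cast : ℤ → 𝕜))‖ =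
      ‖(fun i j => M i j : Fin d → Fin d → ℤ)‖ := by
    have hi : ∀ z : ℤ, ‖(z : 𝕜)‖₊ = ‖z‖₊ := fun z => by
      ext
      rw [coe_nnnorm, coe_nnnorm, ← RCLike.ofReal_intCast, RCLike.norm_ofReal, Int.norm_eq_abs]
    simp only [Pi.norm_def, Pi.nnnorm_def]
    simp [Matrix.ofLinearEquiv, hi]
  rw [← he]
  exact h _

end NormComparison


attribute [local instance] Matrix.linftyOpNormedRing Matrix.linftyOpNormedAlgebra

/-! ### The case of joint spectral radius 1 -/

section IntegerMatrices

variable {d : ℕ} {ι : Type*} {A : ι → Matrix (Fin d) (Fin d) ℤ} {m : ℕ → ℝ} {K : ℝ}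

/-- An eigenvalue z of a word has |z|^n bounded by a constant times m (n |w|), which is
subexponential in n. -/
theorem norm_roots_charpoly_le_one (hm : ∀ n, 0 < m n)
    (hle : ∀ w, ‖(wordProd A w).map (Int.cast : ℤ → ℂ)‖ ≤ K * m w.length)
    (hL : Tendsto (fun n : ℕ => Real.log (m n) / n) atTop (𝓝 0)) (w : List ι) :
    ∀ z ∈ ((wordProd A w).map (Int.cast : ℤ → ℂ)).charpoly.roots, ‖z‖ ≤ 1 := by
  intro z hz
  have : CompleteSpace (Matrix (Fin d) (Fin d) ℂ) := FiniteDimensional.complete ℂ _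
  by_contra! hz1
  have hz0 : z ∈ spectrum ℂ ((wordProd A w).map (Int.cast : ℤ → ℂ)) :=
    Matrix.mem_spectrum_iff_isRoot_charpoly.2 (Polynomial.isRoot_of_mem_roots hz)
  set I := ‖(1 : Matrix (Fin d) (Fin d) ℂ)‖
  have hbound : ∀ n : ℕ, ‖z‖ ^ n ≤ K * I * m (n * w.length) := by
    intro n
    have h1 := spectrum.norm_le_norm_mul_of_mem (spectrum.pow_mem_pow _ n hz0)
    have h2 := hle (List.replicate n w).flatten
    have h3 : ((wordProd A w) ^ n).map (Int.cast : ℤ → ℂ) =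
        (wordProd A w).map (Int.cast : ℤ → ℂ) ^ n :=
      map_pow (Int.castRingHom ℂ).mapMatrix _ n
    rw [wordProd_flatten_replicate, h3] at h2
    simp only [List.length_flatten, List.map_replicate, List.sum_replicate, smul_eq_mul] at h2
    rw [norm_pow] at h1
    calc _ ≤ _ := h1
      _ ≤ K * m (n * w.length) * I := by gcongr
      _ = _ := by ring
  have hKI : 0 < K * I := by
    have := hbound 0
    rw [pow_zero] at this
    by_contra! hneg
    linarith [mul_nonpos_of_nonpos_of_nonneg hneg (hm (0 * w.length)).le]
  have hlog : ∀ n : ℕ, n * Real.log ‖z‖ ≤ Real.log (K * I) + Real.log (m (n * w.length)) := by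
    intro n
    rw [← Real.log_mul hKI.ne' (hm _).ne', ← Real.log_pow]
    exact Real.log_le_log (by positivity) (hbound n)
  have hlim : Tendsto (fun n : ℕ => Real.log (m (n * w.length)) / n) atTop (𝓝 0) := by
    rcases w.length.eq_zero_or_pos with h0 | h0
    · simp only [h0, mul_zero]
      exact tendsto_const_div_atTop_nhds_zero_nat _
    · have h1 := (hL.comp (tendsto_id.atTop_mul_const' (r := w.length) h0)).mul_const
        (w.length : ℝ)
      rw [zero_mul] at h1
      refine h1.congr fun n => ?_
      have : (w.length : ℝ) ≠ 0 := by exact_mod_cast h0.ne'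
      simp only [Function.comp_apply, id_eq, Nat.cast_mul]
      rw [div_mul_eq_mul_div, mul_div_mul_right _ _ this]
  have hlim2 := (tendsto_const_div_atTop_nhds_zero_nat (Real.log (K * I))).add hlim
  rw [add_zero] at hlim2
  have hfin : Real.log ‖z‖ ≤ 0 := by
    refine ge_of_tendsto hlim2 ?_
    filter_upwards [eventually_gt_atTop 0] with n hn
    rw [← add_div, le_div_iff₀ (by exact_mod_cast hn), mul_comm]
    exact hlog n
  exact absurd (Real.log_pos hz1) (not_lt.2 hfin)

theorem exists_pow_bounds_of_tendsto_log_div [Finite ι] {c C : ℝ} (hc : 0 < c)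
    (hcm : ∀ n, c ≤ m n) (hC : 0 < C) (hsub : ∀ a b, m (a + b) ≤ C * m a * m b)
    (hK : 0 < K)
    (hle : ∀ w, ‖(wordProd A w).map (Int.cast : ℤ → ℂ)‖ ≤ K * m w.length)
    {K' : ℝ} (hK' : 0 < K') (hatt : ∀ n, ∃ w : List ι, w.length = n ∧
      m n ≤ K' * ‖(wordProd A w).map (Int.cast : ℤ → ℂ)‖)
    (hL : Tendsto (fun n : ℕ => Real.log (m n) / n) atTop (𝓝 0)) :
    ∃ (k : ℕ) (C₁ C₂ : ℝ), 0 < C₁ ∧ 0 < C₂ ∧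
      ∀ n : ℕ, 1 ≤ n → C₁ * (n : ℝ) ^ k ≤ m n ∧ m n ≤ C₂ * (n : ℝ) ^ k := by
  have hm : ∀ n, 0 < m n := fun n => hc.trans_le (hcm n)
  obtain ⟨B, hB, hroots⟩ := exists_pow_eq_one_of_norm_roots_le (Set.range (wordProd A))
    (by rintro _ ⟨w, rfl⟩ n; exact ⟨_, wordProd_flatten_replicate A n w⟩)
    (by rintro _ ⟨w, rfl⟩; exact norm_roots_charpoly_le_one hm hle hL w)
  let φ : Matrix (Fin d) (Fin d) ℤ →+* Matrix (Fin d) (Fin d) ℂ := (Int.castRingHom ℂ).mapMatrix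
  let a : ι → Matrix (Fin d) (Fin d) ℂ := fun i => φ (A i)
  have ha : ∀ w, wordProd a w = (wordProd A w).map (Int.cast : ℤ → ℂ) := fun w =>
    (wordProd_map φ A w).symm
  have hH : ∀ w, wordProd a w ^ d * (wordProd a w ^ B - 1) ^ d = 0 := fun w => by
    rw [ha]
    exact pow_mul_pow_sub_one_pow_eq_zero _ (hroots _ ⟨w, rfl⟩)
  -- This excludes d = 0, where m 0 would not be positive.
  have hnt : Nontrivial (Matrix (Fin d) (Fin d) ℂ) := by
    by_contra h
    rw [not_nontrivial_iff_subsingleton] at h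
    obtain ⟨w, -, hw⟩ := hatt 0
    rw [← ha, Subsingleton.elim (wordProd a w) 0, norm_zero, mul_zero] at hw
    linarith [hm 0]
  obtain ⟨k, ⟨C', hub⟩, Y, α, β, c', hc', hlen, hlb⟩ :=
    exists_polynomial_growth_of_pow_mul_pow_eq_zero a hB hH
  simp only [ha] at hub hlb
  refine ⟨k, exists_pow_bounds hc hcm hC hsub (C' := K' * C') (α := α) (β := β)
    (c' := c' / K) ?_ (by positivity) ?_⟩
  · intro n
    obtain ⟨w, rfl, hw⟩ := hatt n
    refine hw.trans ?_
    rw [mul_assoc]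
    exact mul_le_mul_of_nonneg_left (hub w) hK'.le
  · filter_upwards [hlb] with t ht
    rw [div_mul_eq_mul_div, div_le_iff₀ hK, ← hlen, mul_comm (m _)]
    exact ht.trans (hle (Y t))

end IntegerMatrices

/-! ### Words attaining the maximum -/

section MaxNorm

variable {𝕜 : Type*} [RCLike 𝕜] {d : ℕ} (N : Seminorm 𝕜 (Matrix (Fin d) (Fin d) 𝕜))
  (𝒜 : Finset (Matrix (Fin d) (Fin d) 𝕜))

theorem le_maxNorm (w : List 𝒜) :
    N (wordProd (fun M : 𝒜 => (M : Matrix (Fin d) (Fin d) 𝕜)) w) ≤ maxNorm N 𝒜 w.length := by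
  refine le_trans (le_of_eq ?_) (le_ciSup (Set.finite_range _).bddAbove w.get)
  congr 2
  conv_lhs => rw [← List.ofFn_get w]
  rw [wordProd, List.map_ofFn]
  rfl

theorem exists_maxNorm_eq [Nonempty 𝒜] (n : ℕ) : ∃ w : List 𝒜, w.length = n ∧
    maxNorm N 𝒜 n = N (wordProd (fun M : 𝒜 => (M : Matrix (Fin d) (Fin d) 𝕜)) w) := by
  obtain ⟨w, hw⟩ := exists_eq_ciSup_of_finite
    (f := fun w : Fin n → 𝒜 => N (List.ofFn fun i => (w i : Matrix (Fin d) (Fin d) 𝕜)).prod)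
  refine ⟨List.ofFn w, List.length_ofFn, hw.symm.trans ?_⟩
  rw [wordProd, List.map_ofFn]
  rfl

variable {N 𝒜}

theorem NonDegenerate.nonempty (h : NonDegenerate N 𝒜) : Nonempty 𝒜 := by
  by_contra hne
  rw [not_nonempty_iff] at hne
  refine h (tendsto_const_nhds.congr' ?_)
  filter_upwards [eventually_gt_atTop 0] with n hn
  have : IsEmpty (Fin n → 𝒜) := ⟨fun w => hne.elim (w ⟨0, hn⟩)⟩
  rw [maxNorm, Real.iSup_of_isEmpty]

/-- If all products of length n vanished, so would all longer ones. -/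
theorem NonDegenerate.exists_wordProd_ne_zero (h : NonDegenerate N 𝒜) (n : ℕ) :
    ∃ w : List 𝒜, w.length = n ∧
      wordProd (fun M : 𝒜 => (M : Matrix (Fin d) (Fin d) 𝕜)) w ≠ 0 := by
  by_contra! hcon
  have := h.nonempty
  refine h (tendsto_const_nhds.congr' ?_)
  filter_upwards [eventually_ge_atTop n] with l hl
  obtain ⟨w, hw, hmax⟩ := exists_maxNorm_eq N 𝒜 l
  rw [hmax, ← List.take_append_drop n w, wordProd_append,
    hcon (w.take n) (by simp [hw, hl]), zero_mul, map_zero]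

end MaxNorm

end MatrixGrowth

/-! ### The main theorem -/

theorem theorem1p1 {𝕜 : Type*} [RCLike 𝕜] {d : ℕ}
    (N : Seminorm 𝕜 (Matrix (Fin d) (Fin d) 𝕜)) (hN : ∀ M, N M = 0 → M = 0)
    (𝒜 : Finset (Matrix (Fin d) (Fin d) 𝕜))
    (hint : ∀ M ∈ 𝒜, ∀ i j, ∃ z : ℤ, M i j = (z : 𝕜))
    (hnd : MatrixGrowth.NonDegenerate N 𝒜) :
    -- the two limits exist
    Tendsto (MatrixGrowth.rootSeq N 𝒜) atTop (𝓝 (MatrixGrowth.jointSpectralRadius N 𝒜)) ∧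
    Tendsto (MatrixGrowth.logRatio N 𝒜) atTop (𝓝 (MatrixGrowth.grDeg N 𝒜)) ∧
    ((∃ k : ℕ, MatrixGrowth.grDeg N 𝒜 = (k : EReal)) ∨ MatrixGrowth.grDeg N 𝒜 = ⊤) ∧
    ((∃ k : ℕ, MatrixGrowth.grDeg N 𝒜 = (k : EReal)) ↔
      MatrixGrowth.jointSpectralRadius N 𝒜 = 1) ∧
    (∀ k : ℕ, MatrixGrowth.grDeg N 𝒜 = (k : EReal) →
      ∃ C₁ C₂ : ℝ, 0 < C₁ ∧ 0 < C₂ ∧ ∀ n : ℕ, 1 ≤ n →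
        C₁ * (n : ℝ) ^ k ≤ MatrixGrowth.maxNorm N 𝒜 n ∧
        MatrixGrowth.maxNorm N 𝒜 n ≤ C₂ * (n : ℝ) ^ k) := by
  let _ : NormedRing (Matrix (Fin d) (Fin d) ℂ) := Matrix.linftyOpNormedRing
  let _ : NormedAlgebra ℂ (Matrix (Fin d) (Fin d) ℂ) := Matrix.linftyOpNormedAlgebra
  set m := MatrixGrowth.maxNorm N 𝒜
  have hne := hnd.nonempty
  choose! Z hZ using hint
  let A : 𝒜 → Matrix (Fin d) (Fin d) ℤ := fun M => Matrix.of (Z M)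
  let φ : Matrix (Fin d) (Fin d) ℤ →+* Matrix (Fin d) (Fin d) 𝕜 :=
    (Int.castRingHom 𝕜).mapMatrix
  have hA : ∀ w : List 𝒜,
      MatrixGrowth.wordProd (fun M : 𝒜 => (M : Matrix (Fin d) (Fin d) 𝕜)) w =
      (MatrixGrowth.wordProd A w).map (Int.cast : ℤ → 𝕜) := by
    intro w
    have h1 : (fun M : 𝒜 => (M : Matrix (Fin d) (Fin d) 𝕜)) = fun M => φ (A M) := by
      funext M
      ext i j
      exact hZ M M.2 i j
    rw [h1, ← MatrixGrowth.wordProd_map]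
    rfl
  obtain ⟨c₁, C₁, hc₁, hC₁, h₁⟩ := MatrixGrowth.exists_seminorm_bounds_intMatrix N hN
  obtain ⟨c₂, C₂, hc₂, hC₂, h₂⟩ := MatrixGrowth.exists_seminorm_bounds_intMatrix
    (normSeminorm ℂ (Matrix (Fin d) (Fin d) ℂ)) fun M hM => norm_eq_zero.1 hM
  simp only [coe_normSeminorm] at h₂
  have hlow : ∀ M : Matrix (Fin d) (Fin d) ℤ,
      ‖M.map (Int.cast : ℤ → ℂ)‖ ≤ C₂ / c₁ * N (M.map (Int.cast : ℤ → 𝕜)) := by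
    intro M
    rw [div_mul_eq_mul_div, le_div_iff₀ hc₁]
    have := mul_le_mul_of_nonneg_left (h₁ M).1 hC₂.le
    have := mul_le_mul_of_nonneg_left (h₂ M).2 hc₁.le
    linarith
  have hup : ∀ M : Matrix (Fin d) (Fin d) ℤ,
      N (M.map (Int.cast : ℤ → 𝕜)) ≤ C₁ / c₂ * ‖M.map (Int.cast : ℤ → ℂ)‖ := by
    intro M
    rw [div_mul_eq_mul_div, le_div_iff₀ hc₂]
    have := mul_le_mul_of_nonneg_left (h₂ M).1 hC₁.le
    have := mul_le_mul_of_nonneg_left (h₁ M).2 hc₂.le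
    linarith
  have hle : ∀ w, ‖(MatrixGrowth.wordProd A w).map (Int.cast : ℤ → ℂ)‖ ≤
      C₂ / c₁ * m w.length := fun w =>
    (hlow _).trans (mul_le_mul_of_nonneg_left
      (by rw [← hA]; exact MatrixGrowth.le_maxNorm N 𝒜 w) (by positivity))
  have hatt : ∀ n, ∃ w : List 𝒜, w.length = n ∧
      m n ≤ C₁ / c₂ * ‖(MatrixGrowth.wordProd A w).map (Int.cast : ℤ → ℂ)‖ := by
    intro n
    obtain ⟨w, hw, hmax⟩ := MatrixGrowth.exists_maxNorm_eq N 𝒜 n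
    refine ⟨w, hw, ?_⟩
    rw [show m n = _ from hmax, hA]
    exact hup _
  -- Integrality enters: some product of length n is nonzero and so has an entry of modulus at least
  -- 1.
  have hcm : ∀ n, c₁ ≤ m n := by
    intro n
    obtain ⟨w, rfl, hw⟩ := hnd.exists_wordProd_ne_zero n
    refine le_trans ?_ (MatrixGrowth.le_maxNorm N 𝒜 w)
    rw [hA] at hw ⊢
    refine le_trans (le_mul_of_one_le_right hc₁.le ?_) (h₁ _).1
    obtain ⟨i, j, hij⟩ : ∃ i j, MatrixGrowth.wordProd A w i j ≠ 0 := by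
      by_contra! h0
      exact hw (by ext i j; simp [h0])
    calc (1 : ℝ) ≤ ‖MatrixGrowth.wordProd A w i j‖ := by
          rw [Int.norm_eq_abs]; exact_mod_cast Int.one_le_abs hij
      _ ≤ ‖fun j => MatrixGrowth.wordProd A w i j‖ :=
          norm_le_pi_norm (fun j => MatrixGrowth.wordProd A w i j) j
      _ ≤ _ := norm_le_pi_norm (fun i j => MatrixGrowth.wordProd A w i j) i
  -- One passage from N to the complex norm for the whole word, and one passage back for each of its
  -- two halves.
  set C := C₁ / c₂ * (C₂ / c₁) * (C₂ / c₁)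
  have hC : 0 < C := by positivity
  have hm : ∀ n, 0 < m n := fun n => hc₁.trans_le (hcm n)
  have hsub : ∀ a b, m (a + b) ≤ C * m a * m b := by
    intro a b
    obtain ⟨w, hw, hmax⟩ := hatt (a + b)
    have h1 := hle (w.take a)
    have h2 := hle (w.drop a)
    rw [List.length_take, hw, min_eq_left (Nat.le_add_right a b)] at h1
    rw [List.length_drop, hw, Nat.add_sub_cancel_left] at h2
    have h3 : (MatrixGrowth.wordProd A w).map (Int.cast : ℤ → ℂ) =
        (MatrixGrowth.wordProd A (w.take a)).map (Int.cast : ℤ → ℂ) *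
        (MatrixGrowth.wordProd A (w.drop a)).map (Int.cast : ℤ → ℂ) := by
      conv_lhs => rw [← List.take_append_drop a w, MatrixGrowth.wordProd_append]
      exact map_mul (Int.castRingHom ℂ).mapMatrix _ _
    rw [h3] at hmax
    refine hmax.trans ?_
    calc _ ≤ C₁ / c₂ * ((C₂ / c₁ * m a) * (C₂ / c₁ * m b)) := by
          refine mul_le_mul_of_nonneg_left ((norm_mul_le _ _).trans ?_) (by positivity)
          exact mul_le_mul h1 h2 (norm_nonneg _) (by have := hm a; positivity)
      _ = _ := by ring
  obtain ⟨L, hL0, hL, hLle⟩ := MatrixGrowth.exists_tendsto_log_div hc₁ hcm hC hsub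
  have hroot : Tendsto (MatrixGrowth.rootSeq N 𝒜) atTop (𝓝 (Real.exp L)) :=
    MatrixGrowth.tendsto_rpow_of_tendsto_log_div hm hL
  have hρ : MatrixGrowth.jointSpectralRadius N 𝒜 = Real.exp L := hroot.limUnder_eq
  rcases hL0.eq_or_lt with rfl | hLpos
  · obtain ⟨k, D₁, D₂, hD₁, hD₂, hbd⟩ := MatrixGrowth.exists_pow_bounds_of_tendsto_log_div
      hc₁ hcm hC hsub (by positivity) hle (by positivity) hatt hL
    have hlog : Tendsto (MatrixGrowth.logRatio N 𝒜) atTop (𝓝 (k : EReal)) :=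
      (continuous_coe_real_ereal.tendsto _).comp
        (MatrixGrowth.tendsto_log_div_log_of_pow_bounds hD₁ hD₂ hbd)
    have hdeg : MatrixGrowth.grDeg N 𝒜 = k := hlog.limUnder_eq
    rw [hρ, hdeg, Real.exp_zero]
    refine ⟨by simpa using hroot, hlog, Or.inl ⟨k, rfl⟩, ⟨fun _ => rfl, fun _ => ⟨k, rfl⟩⟩, ?_⟩
    intro k' hk'
    obtain rfl : k = k' := by exact_mod_cast hk'
    exact ⟨D₁, D₂, hD₁, hD₂, hbd⟩
  · have hlog : Tendsto (MatrixGrowth.logRatio N 𝒜) atTop (𝓝 ⊤) :=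
      EReal.tendsto_coe_nhds_top_iff.2 (MatrixGrowth.tendsto_log_div_log_atTop hLpos hLle)
    have hdeg : MatrixGrowth.grDeg N 𝒜 = ⊤ := hlog.limUnder_eq
    have htop : ∀ k : ℕ, (⊤ : EReal) ≠ k := fun k => (EReal.natCast_ne_top k).symm
    rw [hρ, hdeg]
    refine ⟨hroot, hlog, Or.inr rfl, ⟨?_, ?_⟩, ?_⟩
    · rintro ⟨k, hk⟩
      exact absurd hk (htop k)
    · intro h
      exact absurd (Real.exp_eq_one_iff L |>.1 h) hLpos.ne'
    · intro k hk
      exact absurd hk (htop k)
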